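/- **Lemma 2.3.** Let $\mathcal S$ be a countable state space, $\mathcal A$ an action set with $|\mathcal A|=2$, $\beta$ a fixed probability distribution on $\mathcal S$, and $\Pi$ a class of policies $\pi:\mathcal S\to\mathcal A$ of VC dimension $d\in\mathbb N$. *Protocol.* In round $t=1,\dots,T$ the adversary $V$, which maps each history to a distribution on $\mathcal S\times\mathcal A$, draws a state and a correct action $(s_t,a_t^m)\sim V(\mathcal F_t)$, where $\mathcal F_t=(s_i,a_i,a_i^mq_i)_{i<t}$; the algorithm $\Gamma$ observes $s_t$, draws a query decision $q_t\in\{0,1\}$ from a distribution depending on $(\mathcal F_t,s_t)$, observes $a_t^mq_t$ (that is, $a_t^m$ if $q_t=1$ and a dummy symbol $0\notin\mathcal A$ otherwise), and draws its action $a_t\in\mathcal A$ from a distribution depending on $(\mathcal F_t,s_t,a_t^mq_t)$. The algorithm is *full-feedback* if it always chooses $q_t=1$, and *query-agnostic* if the distribution of $a_t$ does not depend on the query result of the same round (only on $\mathcal F_t$ and $s_t$). Algorithms and adversaries may depend on the horizon $T$. For $\sigma\in(0,1]$ the adversary is *$\sigma$-smooth* if for every history $\mathcal F$ and every $X\subseteq\mathcal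 S$, $\Pr_{(s,a)\sim V(\mathcal F)}[s\in X]\le\frac1\sigma\beta(X)$. The play of $\Gamma$ against $V$ is *realizable* if there is a fixed $\pi^*\in\Pi$ such that almost surely $\pi^*(s_t)=a_t^m$ for all $t\in\{1,\dots,T\}$. The regret is $$R(T,\Gamma,V)=\sup_{\pi\in\Pi}\ \mathbb E\Big[\sum_{t=1}^T\mathbf 1(a_t\ne a_t^m)-\sum_{t=1}^T\mathbf 1(\pi(s_t)\ne a_t^m)\Big].$$ *Claim.* There is an absolute constant $C>0$ such that for all $\mathcal S,\mathcal A,\beta,\Pi,d$ as above there is a full-feedback, query-agnostic algorithm $\Gamma$ (knowing $T$, $\beta$ and $\Pi$, but neither $\sigma$ nor the adversary) such that for every integer $T\ge1$, every $\sigma\in(0,1]$ and every $\sigma$-smooth adversary $V$ for which the play of $\Gamma$ against $V$ is realizable, $$R(T,\Gamma,V)\le C\,(d\log T+\sigma^{-1}).$$ Moreover, for each $T\ge1$ the algorithm can be taken to be exponential weights on a $1/T$-cover of $\Pi$: there are $\eta>0$ and a finite set $\tilde\Pi$ of policies $\mathcal S\to\mathcal A$, such that every $\pi\in\Pi$ has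 some $\tilde\pi\in\tilde\Pi$ with $\Pr_{s\sim\beta}[\pi(s)\ne\tilde\pi(s)]\le 1/T$, and after each history the algorithm takes the action $\tilde\pi(s_t)$ of a policy $\tilde\pi\in\tilde\Pi$ drawn with probability proportional to $\exp(-\eta L(\tilde\pi))$, where $L(\tilde\pi)$ is the number of past queried rounds $i$ with $\tilde\pi(s_i)\ne a_i^m$. -/

import Mathlib

universe u v

namespace OnlineLearning

/-- A history: the list, in chronological order, of the triples `(sᵢ, aᵢ, aᵢᵐ qᵢ)` of the past
rounds. The last component is `some aᵢᵐ` if the algorithm queried in round `i`, and `none` (the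
dummy action `0 ∉ A`) if it did not. -/
abbrev History (S : Type u) (A : Type v) : Type (max u v) := List (S × A × Option A)

/-- An adversary maps each history to the joint distribution of the next state and the next
correct action. -/
abbrev Adversary (S : Type u) (A : Type v) : Type (max u v) := History S A → PMF (S × A)

/-- An (active learning) algorithm: a query function and an action function. The third argument
of `act` is the query result `aₜᵐ qₜ` of the current round. -/
structure Algorithm (S : Type u) (A : Type v) where
  query : History S A → S → PMF Bool
  act : History S A → S → Option A → PMF A

variable {S : Type u} {A : Type v}

/-- A full-feedback algorithm always queries. -/
def Algorithm.IsFullFeedback (Γ : Algorithm S A) : Prop :=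
  ∀ (F : History S A) (s : S), Γ.query F s = PMF.pure true

/-- A query-agnostic algorithm does not use the query result of the current round when it chooses
its action in that round. -/
def Algorithm.IsQueryAgnostic (Γ : Algorithm S A) : Prop :=
  ∀ (F : History S A) (s : S) (a : A), Γ.act F s none = Γ.act F s (some a)

/-- Everything that happens in one round: the state `sₜ`, the correct action `aₜᵐ`, the query
decision `qₜ` and the action `aₜ`. -/
structure Round (S : Type u) (A : Type v) where
  state : S
  correct : A
  query : Bool
  action : A

/-- The query result `aᵐ q`. -/
def queryResult (am : A) (q : Bool) : Option A := if q then some am else none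

/-- The part of a list of rounds that enters the history. -/
def toHistory (τ : List (Round S A)) : History S A :=
  τ.map fun r => (r.state, r.action, queryResult r.correct r.query)

/-- One round of the protocol after the history `F`: first `(s, aᵐ) ∼ V F`, then
`q ∼ Γ.query F s`, then `a ∼ Γ.act F s (aᵐ q)`. -/
noncomputable def playRound (Γ : Algorithm S A) (V : Adversary S A) (F : History S A) :
    PMF (Round S A) :=
  (V F).bind fun x =>
    (Γ.query F x.1).bind fun q =>
      (Γ.act F x.1 (queryResult x.2 q)).map fun a => ⟨x.1, x.2, q, a⟩

/-- The law of the first `T` rounds (a random list of length `T`, in chronological order) when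
`Γ` plays against `V`. -/
noncomputable def play (Γ : Algorithm S A) (V : Adversary S A) : ℕ → PMF (List (Round S A))
  | 0 => PMF.pure []
  | T + 1 => (play Γ V T).bind fun τ => (playRound Γ V (toHistory τ)).map fun r => τ ++ [r]

/-- The expectation `E[f]` under a discrete distribution. (It is only used for functions that are
bounded on the support of `p`, so that the series converges absolutely.) -/
noncomputable def expect {Ω : Type*} (p : PMF Ω) (f : Ω → ℝ) : ℝ := ∑' ω, (p ω).toReal * f ω

open Classical in
/-- The binary loss `1(a ≠ aᵐ)`. -/
noncomputable def binaryLoss (a am : A) : ℝ := if a = am then 0 else 1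

/-- The standard adversarial regret of `Γ` against `V` after `T` rounds,
`sup_{π ∈ Π} E[∑ₜ ℓ(aₜ, aₜᵐ) - ∑ₜ ℓ(π(sₜ), aₜᵐ)]`, as a supremum of extended reals. -/
noncomputable def regret (P : Set (S → A)) (T : ℕ) (Γ : Algorithm S A) (V : Adversary S A)
    (loss : A → A → ℝ) : EReal :=
  ⨆ π ∈ P, ((expect (play Γ V T) fun τ =>
    (τ.map fun r => loss r.action r.correct).sum -
      (τ.map fun r => loss (π r.state) r.correct).sum : ℝ) : EReal)

/-- `p` is `σ`-smooth with respect to `β`: `p(X) ≤ β(X) / σ` for every `X ⊆ S`. By convention every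
distribution is `0`-smooth. -/
def IsSmooth (σ : ℝ) (β p : PMF S) : Prop :=
  0 < σ → ∀ X : Set S, p.toOuterMeasure X ≤ ENNReal.ofReal (1 / σ) * β.toOuterMeasure X

/-- An adversary is `σ`-smooth if, after every history, the marginal distribution of the next state
is `σ`-smooth. -/
def Adversary.IsSmooth (σ : ℝ) (β : PMF S) (V : Adversary S A) : Prop :=
  ∀ F : History S A, OnlineLearning.IsSmooth σ β ((V F).map Prod.fst)

/-- Realizability of the play of `Γ` against `V` over `T` rounds: some fixed policy of the class
almost surely agrees with the correct action in every round. -/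
def IsRealizable (P : Set (S → A)) (T : ℕ) (Γ : Algorithm S A) (V : Adversary S A) : Prop :=
  ∃ π ∈ P, ∀ τ ∈ (play Γ V T).support, ∀ r ∈ τ, π r.state = r.correct

/-- The class `P` shatters the finite set `X` if every labelling of `X` is realized by a policy
in `P`. (For `|A| = 2` this is the usual notion for binary classes.) -/
def Shatters (P : Set (S → A)) (X : Finset S) : Prop :=
  ∀ f : S → A, ∃ π ∈ P, ∀ x ∈ X, π x = f x

/-- `d` is the VC dimension of `P`: the largest cardinality of a shattered finite set. -/
def HasVCDim (P : Set (S → A)) (d : ℕ) : Prop :=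
  IsGreatest {n : ℕ | ∃ X : Finset S, Shatters P X ∧ X.card = n} d

/-- `Q` is an `ε`-cover of `P` with respect to `β`: every `π ∈ P` agrees with some `π' ∈ Q` outside
a set of `β`-probability at most `ε`. -/
def IsCover (ε : ℝ) (β : PMF S) (P : Set (S → A)) (Q : Finset (S → A)) : Prop :=
  ∀ π ∈ P, ∃ π' ∈ Q, β.toOuterMeasure {s | π s ≠ π' s} ≤ ENNReal.ofReal ε

/-- The cumulative binary loss of the policy `π` on the rounds of `F` whose correct action was
observed. -/
noncomputable def observedLoss (F : History S A) (π : S → A) : ℝ :=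
  (F.map fun x => x.2.2.elim 0 fun am => binaryLoss (π x.1) am).sum

open Classical in
/-- The actions of `Γ` are those of the exponential weights forecaster with learning rate `η` on
the finite policy class `Q`: after the history `F`, it follows the advice of a policy drawn from
`Q` with probability proportional to `exp (-η · (past loss))`. -/
def IsExpWeights (η : ℝ) (Q : Finset (S → A)) (Γ : Algorithm S A) : Prop :=
  ∀ (F : History S A) (s : S) (o : Option A) (a : A),
    (Γ.act F s o a).toReal =
      (∑ π ∈ Q with π s = a, Real.exp (-η * observedLoss F π)) /
        ∑ π ∈ Q, Real.exp (-η * observedLoss F π)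

end OnlineLearning

/-! Run exponential weights with `η = 1` on a finite `1/T`-cover `Q` of `P`. Realizability supplies
one fixed `π' ∈ P` that is always correct; let `π ∈ Q` be a policy covering it. In each round
smoothness bounds the probability that `π` errs by `σ⁻¹ / T`, whatever the history, so `π` makes at
most `σ⁻¹` mistakes in expectation. Since `π` is fixed before play, linearity of expectation
suffices even against an adaptive adversary.

Exponential weights loses at most `2 log |Q|` plus twice the loss of `π`, in expectation. This is a
supermartingale-type argument for `potential`: it starts at `2 log |Q|`, dominates the algorithm's
loss, and rises in expected value per round by at most twice the error probability of `π`
(`eexpect_playRound_potential_le`).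

The entropy `log |Q| = O(d log T)`, up to an additive constant, is Dudley's packing bound
(`IsPacking.log_card_le`): a few points separate all members of a packing, and Sauer–Shelah limits
the number of traces on those points. -/

namespace OnlineLearning

variable {S : Type u} {A : Type v}

/-! ### Packing and covering numbers of VC classes -/

/-- If every event `E i`, `i ∈ M`, has probability more than `ε`, some point lies in at least an
`ε`-fraction of them. -/
theorem exists_mem_many {ι : Type*} (β : PMF S) {ε : ℝ} (M : Finset ι)
    (E : ι → Set S) (hE : ∀ i ∈ M, ENNReal.ofReal ε < β.toOuterMeasure (E i)) :
    ∃ s : S, ε * (M.card : ℝ) ≤ ∑ i ∈ M, (E i).indicator (fun _ => (1 : ℝ)) s := by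
  rcases M.eq_empty_or_nonempty with rfl | hM
  · obtain ⟨s, -⟩ := β.support_nonempty
    exact ⟨s, by simp⟩
  -- The `β`-average of the number of events containing `s` is the sum of their probabilities, which
  -- exceeds `ε * M.card`.
  by_contra! hcon
  have hpt : ∀ s, ∑ i ∈ M, (E i).indicator β s ≤ β s * ENNReal.ofReal (ε * M.card) := by
    intro s
    have h1 : ∑ i ∈ M, (E i).indicator β s
        = β s * ENNReal.ofReal (∑ i ∈ M, (E i).indicator (fun _ => (1 : ℝ)) s) := by
      rw [ENNReal.ofReal_sum_of_nonneg
        (fun i _ => Set.indicator_nonneg (fun _ _ => zero_le_one) _), Finset.mul_sum]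
      refine Finset.sum_congr rfl fun i _ => ?_
      by_cases h : s ∈ E i <;> simp [h]
    rw [h1]
    gcongr
    exact (hcon s).le
  have h2 : ∑ i ∈ M, β.toOuterMeasure (E i) ≤ ENNReal.ofReal (ε * M.card) := by
    simp_rw [PMF.toOuterMeasure_apply]
    rw [← Summable.tsum_finsetSum (fun _ _ => ENNReal.summable)]
    refine (ENNReal.tsum_le_tsum hpt).trans ?_
    rw [ENNReal.tsum_mul_right, PMF.tsum_coe, one_mul]
  have h3 : ∑ _i ∈ M, ENNReal.ofReal ε < ∑ i ∈ M, β.toOuterMeasure (E i) :=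
    ENNReal.sum_lt_sum_of_nonempty hM hE
  rw [Finset.sum_const, nsmul_eq_mul] at h3
  rw [mul_comm ε, ENNReal.ofReal_mul (by positivity), ENNReal.ofReal_natCast] at h2
  exact absurd (h3.trans_le h2) (lt_irrefl _)

open Classical in
/-- Greedy choice of `n` points that miss only a `(1 - ε) ^ n`-fraction of a finite family of events
of probability more than `ε`. -/
theorem exists_points_missing_few {ι : Type*} (β : PMF S) {ε : ℝ} (hε1 : ε ≤ 1)
    (D : Finset ι) (E : ι → Set S) (hE : ∀ i ∈ D, ENNReal.ofReal ε < β.toOuterMeasure (E i))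
    (n : ℕ) : ∃ X : Finset S, X.card ≤ n ∧
      ((D.filter fun i => ∀ x ∈ X, x ∉ E i).card : ℝ) ≤ (1 - ε) ^ n * D.card := by
  induction n with
  | zero => exact ⟨∅, by simp⟩
  | succ n ih =>
    obtain ⟨X, hX, hM⟩ := ih
    set M := D.filter fun i => ∀ x ∈ X, x ∉ E i with hMdef
    obtain ⟨s, hs⟩ := exists_mem_many β M E fun i hi => hE i (Finset.mem_filter.1 hi).1
    refine ⟨insert s X, (Finset.card_insert_le _ _).trans (by omega), ?_⟩
    have h1 : (D.filter fun i => ∀ x ∈ insert s X, x ∉ E i) = M.filter fun i => s ∉ E i := by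
      ext i
      simp only [hMdef, Finset.mem_filter, Finset.mem_insert, forall_eq_or_imp]
      tauto
    have h2 : ∑ i ∈ M, (E i).indicator (fun _ => (1 : ℝ)) s = ((M.filter fun i => s ∈ E i).card : ℝ) := by
      rw [Finset.card_filter]
      push_cast
      rfl
    have h3 := M.card_filter_add_card_filter_not (fun i => s ∈ E i)
    have h4 : ((M.filter fun i => s ∈ E i).card : ℝ) + (M.filter fun i => s ∉ E i).card = M.card := by
      exact_mod_cast h3
    rw [h1]
    calc ((M.filter fun i => s ∉ E i).card : ℝ) ≤ (1 - ε) * M.card := by linarith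
      _ ≤ (1 - ε) * ((1 - ε) ^ n * D.card) := by
          have : 0 ≤ 1 - ε := by linarith
          gcongr
      _ = _ := by ring

/-- An exponential form of the Sauer–Shelah lemma. -/
theorem card_mul_pow_le_exp {α : Type*} [Fintype α] [DecidableEq α] (𝒜 : Finset (Finset α))
    {d : ℕ} (hd : 𝒜.vcDim ≤ d) {x : ℝ} (hx : 0 ≤ x) (hx1 : x ≤ 1) :
    (𝒜.card : ℝ) * x ^ d ≤ Real.exp (x * Fintype.card α) := by
  have h1 : (𝒜.card : ℝ) ≤ ∑ k ∈ Finset.Iic 𝒜.vcDim, ((Fintype.card α).choose k : ℝ) := by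
    exact_mod_cast 𝒜.card_le_card_shatterer.trans Finset.card_shatterer_le_sum_vcDim
  calc (𝒜.card : ℝ) * x ^ d
      ≤ (∑ k ∈ Finset.Iic 𝒜.vcDim, ((Fintype.card α).choose k : ℝ)) * x ^ d := by gcongr
    _ = ∑ k ∈ Finset.Iic 𝒜.vcDim, ((Fintype.card α).choose k : ℝ) * x ^ d := Finset.sum_mul ..
    _ ≤ ∑ k ∈ Finset.Iic 𝒜.vcDim, x ^ k * ((Fintype.card α).choose k : ℝ) := by
        refine Finset.sum_le_sum fun k hk => ?_
        rw [mul_comm]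
        gcongr ?_ * _
        -- As `k ≤ d` and `x ≤ 1`, lowering the exponent only increases the power; the sum then
        -- becomes part of a binomial expansion.
        exact pow_le_pow_of_le_one hx hx1 ((Finset.mem_Iic.1 hk).trans hd)
    _ ≤ ∑ k ∈ Finset.range (max 𝒜.vcDim (Fintype.card α) + 1),
          x ^ k * ((Fintype.card α).choose k : ℝ) := by
        refine Finset.sum_le_sum_of_subset_of_nonneg (fun k hk => ?_) fun _ _ _ => by positivity
        have := Finset.mem_Iic.1 hk
        exact Finset.mem_range.2 (by omega)
    _ = ∑ k ∈ Finset.range (Fintype.card α + 1), x ^ k * ((Fintype.card α).choose k : ℝ) := by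
        symm
        refine Finset.sum_subset (Finset.range_subset_range.2 (by omega)) fun k _ hk => ?_
        rw [Nat.choose_eq_zero_of_lt (by simpa using hk)]
        simp
    _ = (x + 1) ^ Fintype.card α := by simp [add_pow]
    _ ≤ (Real.exp x) ^ Fintype.card α := by
        gcongr
        exact Real.add_one_le_exp x
    _ = _ := by rw [← Real.exp_nat_mul, mul_comm]

/-- Lets a policy be encoded by the set where it takes the value `a₀`, so that set-family results
apply. -/
theorem exists_eq_of_iff_of_card_eq_two [Fintype A] (hA : Fintype.card A = 2) :
    ∃ a₀ : A, ∀ b c : A, (b = a₀ ↔ c = a₀) → b = c := by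
  classical
  obtain ⟨a₀, a₁, -, h⟩ := Finset.card_eq_two.1 (Finset.card_univ.trans hA)
  have key : ∀ b : A, b = a₀ ∨ b = a₁ := fun b => by simpa [h] using Finset.mem_univ b
  refine ⟨a₀, fun b c hbc => ?_⟩
  rcases key b with hb | hb <;> rcases key c with hc | hc <;> grind

/-- Growth bound for a class of VC dimension `d` on a finite set of points. -/
theorem card_mul_pow_le_exp_of_separated [Fintype A] (hA : Fintype.card A = 2)
    {P : Set (S → A)} {d : ℕ} (hd : HasVCDim P d) (Q : Finset (S → A)) (hQ : ↑Q ⊆ P)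
    (X : Finset S) (hX : ∀ π ∈ Q, ∀ π' ∈ Q, (∀ x ∈ X, π x = π' x) → π = π')
    {x : ℝ} (hx : 0 ≤ x) (hx1 : x ≤ 1) :
    (Q.card : ℝ) * x ^ d ≤ Real.exp (x * X.card) := by
  classical
  obtain ⟨a₀, ha⟩ := exists_eq_of_iff_of_card_eq_two hA
  let tr : (S → A) → Finset X := fun π => Finset.univ.filter fun y : X => π y = a₀
  have hinj : Set.InjOn tr Q := by
    intro π hπ π' hπ' h
    refine hX π hπ π' hπ' fun y hy => ha _ _ ?_
    have := Finset.ext_iff.1 h ⟨y, hy⟩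
    simpa [tr] using this
  have hvc : (Q.image tr).vcDim ≤ d := by
    refine Finset.sup_le fun s hs => ?_
    rw [Finset.mem_shatterer] at hs
    rw [← Finset.card_map (Function.Embedding.subtype _)]
    refine hd.2 ⟨s.map (Function.Embedding.subtype _), fun f => ?_, rfl⟩
    obtain ⟨u, hu, hsu⟩ := hs (Finset.filter_subset (fun y : X => f y = a₀) s)
    obtain ⟨π, hπ, rfl⟩ := Finset.mem_image.1 hu
    refine ⟨π, hQ hπ, fun _ hz => ?_⟩
    obtain ⟨y, hy, rfl⟩ := Finset.mem_map.1 hz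
    have := Finset.ext_iff.1 hsu y
    refine ha _ _ ?_
    simpa [tr, hy] using this
  have := card_mul_pow_le_exp (Q.image tr) hvc hx hx1
  rwa [Finset.card_image_of_injOn hinj, Fintype.card_coe] at this

/-- A finite set of policies that are pairwise at `β`-distance more than `ε`. -/
def IsPacking (ε : ℝ) (β : PMF S) (Q : Finset (S → A)) : Prop :=
  ∀ π ∈ Q, ∀ π' ∈ Q, π ≠ π' → ENNReal.ofReal ε < β.toOuterMeasure {s | π s ≠ π' s}

/-- Dudley's bound on the packing numbers of a VC class. -/
theorem IsPacking.log_card_le [Fintype A] (hA : Fintype.card A = 2) {β : PMF S}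
    {P : Set (S → A)} {d : ℕ} (hd : HasVCDim P d) {ε : ℝ} (hε : 0 < ε) (hε1 : ε ≤ 1)
    {Q : Finset (S → A)} (hQ : ↑Q ⊆ P) (hne : Q.Nonempty) (hpack : IsPacking ε β Q) :
    Real.log Q.card ≤ 2 * d * Real.log (4 / ε) + 1 / 2 := by
  classical
  have hN : (1 : ℝ) ≤ Q.card := by exact_mod_cast hne.card_pos
  set N : ℝ := (Q.card : ℝ) with hNdef
  have hlog : 0 ≤ Real.log N := Real.log_nonneg hN
  -- Chosen so that `(1 - ε) ^ n ≤ exp (-ε n) ≤ N ^ (-2)`: fewer than one of the `N ^ 2 - N` ordered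
  -- pairs stays unseparated.
  set n := ⌈2 * Real.log N / ε⌉₊ with hn
  have hn1 : 2 * Real.log N / ε ≤ n := Nat.le_ceil _
  have hn2 : (n : ℝ) < 2 * Real.log N / ε + 1 := Nat.ceil_lt_add_one (by positivity)
  obtain ⟨X, hXn, hX⟩ := exists_points_missing_few β hε1 Q.offDiag
    (fun p => {s | p.1 s ≠ p.2 s}) (fun p hp => by
      obtain ⟨h1, h2, h3⟩ := Finset.mem_offDiag.1 hp
      exact hpack _ h1 _ h2 h3) n
  have hpow : (1 - ε) ^ n * N ^ 2 ≤ 1 := by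
    have h1 : (1 - ε) ^ n ≤ Real.exp (-(2 * Real.log N)) := by
      calc (1 - ε) ^ n ≤ (Real.exp (-ε)) ^ n := by
            have : 0 ≤ 1 - ε := by linarith
            gcongr
            exact Real.one_sub_le_exp_neg ε
        _ = Real.exp (-(n * ε)) := by rw [← Real.exp_nat_mul]; ring_nf
        _ ≤ _ := by
            rw [div_le_iff₀ hε] at hn1
            gcongr
    have h2 : N ^ 2 = Real.exp (2 * Real.log N) := by
      rw [two_mul, Real.exp_add, Real.exp_log (by linarith), sq]
    calc (1 - ε) ^ n * N ^ 2 ≤ Real.exp (-(2 * Real.log N)) * Real.exp (2 * Real.log N) := by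
          rw [← h2]; gcongr
      _ = 1 := by rw [← Real.exp_add]; simp
  have hcard : ((Q.offDiag.card : ℕ) : ℝ) = N ^ 2 - N := by
    rw [Finset.offDiag_card, Nat.cast_sub (Nat.le_mul_self _)]
    push_cast
    ring
  have hlt : (1 - ε) ^ n * (N ^ 2 - N) < 1 := by
    rcases eq_or_lt_of_le (pow_nonneg (by linarith : 0 ≤ 1 - ε) n) with h | h
    · rw [← h]; simp
    · nlinarith
  rw [hcard] at hX
  have hempty := hX.trans_lt hlt
  rw [Nat.cast_lt_one, Finset.card_eq_zero] at hempty
  have hsep : ∀ π ∈ Q, ∀ π' ∈ Q, (∀ x ∈ X, π x = π' x) → π = π' := by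
    intro π hπ π' hπ' h
    by_contra hne'
    have : (π, π') ∈ (∅ : Finset ((S → A) × (S → A))) := by
      rw [← hempty]
      simpa [hπ, hπ', hne'] using h
    simp at this
  -- With `x = ε / 4` the exponent is at most `log N / 2 + ε / 4`, so half of `log N` can be
  -- absorbed on the left.
  have hbound := card_mul_pow_le_exp_of_separated hA hd Q hQ X hsep (x := ε / 4)
    (by linarith) (by linarith)
  have hl := Real.log_le_log (by positivity) hbound
  rw [Real.log_exp, Real.log_mul (by positivity) (by positivity), Real.log_pow,
    ← inv_div 4 ε, Real.log_inv] at hl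
  have hXn' : (X.card : ℝ) ≤ n := by exact_mod_cast hXn
  have h5 : ε / 4 * X.card ≤ ε / 4 * (2 * Real.log N / ε + 1) := by
    gcongr
    linarith
  have h6 : ε / 4 * (2 * Real.log N / ε + 1) = Real.log N / 2 + ε / 4 := by
    field_simp
    ring
  rw [inv_div] at hl
  linarith

/-- A maximal packing of a VC class is a small cover. -/
theorem exists_isCover_log_card_le [Fintype A] (hA : Fintype.card A = 2) (β : PMF S)
    {P : Set (S → A)} {d : ℕ} (hd : HasVCDim P d) {ε : ℝ} (hε : 0 < ε) (hε1 : ε ≤ 1) :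
    ∃ Q : Finset (S → A), Q.Nonempty ∧ IsCover ε β P Q ∧
      Real.log Q.card ≤ 2 * d * Real.log (4 / ε) + 1 / 2 := by
  classical
  by_contra! hcon
  obtain ⟨π₀, hπ₀⟩ : P.Nonempty := by
    obtain ⟨X, hX, -⟩ := hd.1
    have : Nonempty A := Fintype.card_pos_iff.1 (by omega)
    obtain ⟨π, hπ, -⟩ := hX fun _ => Classical.arbitrary A
    exact ⟨π, hπ⟩
  -- If no small cover exists, no packing is maximal: a policy it fails to cover can be adjoined,
  -- and packings grow past the entropy bound.
  have key : ∀ k : ℕ, ∃ Q : Finset (S → A), ↑Q ⊆ P ∧ IsPacking ε β Q ∧ Q.card = k + 1 := by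
    intro k
    induction k with
    | zero => exact ⟨{π₀}, by simpa using hπ₀, by simp [IsPacking], by simp⟩
    | succ k ih =>
      obtain ⟨Q, hQP, hpack, hcard⟩ := ih
      have hne : Q.Nonempty := Finset.card_pos.1 (by omega)
      have hnc : ¬ IsCover ε β P Q := fun h =>
        absurd (hpack.log_card_le hA hd hε hε1 hQP hne) (hcon Q hne h).not_ge
      simp only [IsCover, not_forall, not_exists, not_and, not_le] at hnc
      obtain ⟨π, hπ, hfar⟩ := hnc
      have hnot : π ∉ Q := fun h => by simpa using hfar π h
      refine ⟨insert π Q, ?_, ?_, by rw [Finset.card_insert_of_notMem hnot, hcard]⟩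
      · rw [Finset.coe_insert]
        exact Set.insert_subset hπ hQP
      · intro π₁ h₁ π₂ h₂ h12
        rcases Finset.mem_insert.1 h₁ with rfl | g₁ <;> rcases Finset.mem_insert.1 h₂ with rfl | g₂
        · exact absurd rfl h12
        · exact hfar _ g₂
        · simpa only [ne_comm] using hfar _ g₁
        · exact hpack _ g₁ _ g₂ h12
  obtain ⟨k, hk⟩ := exists_nat_gt (Real.exp (2 * d * Real.log (4 / ε) + 1 / 2))
  obtain ⟨Q, hQP, hpack, hcard⟩ := key k
  have h1 := hpack.log_card_le hA hd hε hε1 hQP (Finset.card_pos.1 (by omega))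
  rw [Real.log_le_iff_le_exp (by rw [hcard]; positivity), hcard] at h1
  push_cast at h1
  linarith

/-! ### Expectations with values in `ENNReal` -/

/-- The expectation of an extended nonnegative function under a discrete distribution. -/
noncomputable def eexpect {Ω : Type*} (p : PMF Ω) (f : Ω → ENNReal) : ENNReal := ∑' ω, p ω * f ω

section Eexpect

variable {Ω Ω' : Type*}

theorem eexpect_pure (ω : Ω) (f : Ω → ENNReal) : eexpect (PMF.pure ω) f = f ω := by
  classical
  rw [eexpect, tsum_eq_single ω fun b hb => by simp [PMF.pure_apply, hb]]
  simp

theorem eexpect_bind (p : PMF Ω) (k : Ω → PMF Ω') (f : Ω' → ENNReal) :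
    eexpect (p.bind k) f = eexpect p fun ω => eexpect (k ω) f := by
  simp only [eexpect, PMF.bind_apply, ← ENNReal.tsum_mul_right, ← ENNReal.tsum_mul_left]
  rw [ENNReal.tsum_comm]
  simp only [mul_assoc]

theorem eexpect_map (p : PMF Ω) (g : Ω → Ω') (f : Ω' → ENNReal) :
    eexpect (p.map g) f = eexpect p (f ∘ g) := by
  simp only [← PMF.bind_pure_comp, eexpect_bind, Function.comp_def, eexpect_pure]

theorem eexpect_mono {p : PMF Ω} {f g : Ω → ENNReal} (h : ∀ ω ∈ p.support, f ω ≤ g ω) :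
    eexpect p f ≤ eexpect p g := by
  refine ENNReal.tsum_le_tsum fun ω => ?_
  by_cases hω : ω ∈ p.support
  · gcongr
    exact h ω hω
  · simp [(PMF.apply_eq_zero_iff p ω).2 hω]

theorem eexpect_const (p : PMF Ω) (c : ENNReal) : eexpect p (fun _ => c) = c := by
  rw [eexpect, ENNReal.tsum_mul_right, p.tsum_coe, one_mul]

theorem eexpect_add (p : PMF Ω) (f g : Ω → ENNReal) :
    eexpect p (fun ω => f ω + g ω) = eexpect p f + eexpect p g := by
  simp only [eexpect, mul_add, ENNReal.tsum_add]

theorem eexpect_const_mul (p : PMF Ω) (c : ENNReal) (f : Ω → ENNReal) :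
    eexpect p (fun ω => c * f ω) = c * eexpect p f := by
  simp only [eexpect, ← ENNReal.tsum_mul_left, mul_left_comm]

/-- Transfers bounds to real expectations: finiteness of the extended expectation gives summability
of the dominating `g`. -/
theorem expect_le_of_eexpect_le (p : PMF Ω) {f g : Ω → ℝ} (hfg : ∀ ω, f ω ≤ g ω)
    (hg : ∀ ω, 0 ≤ g ω) {B : ℝ} (hB : 0 ≤ B)
    (h : eexpect p (fun ω => ENNReal.ofReal (g ω)) ≤ ENNReal.ofReal B) : expect p f ≤ B := by
  have hreal : ∀ ω, (p ω * ENNReal.ofReal (g ω)).toReal = (p ω).toReal * g ω := fun ω => by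
    rw [ENNReal.toReal_mul, ENNReal.toReal_ofReal (hg ω)]
  have hne : ∑' ω, p ω * ENNReal.ofReal (g ω) ≠ ⊤ := (h.trans_lt ENNReal.ofReal_lt_top).ne
  have hsum : Summable fun ω => (p ω).toReal * g ω := by
    simpa only [hreal] using ENNReal.summable_toReal hne
  have htsum : ∑' ω, (p ω).toReal * g ω ≤ B := by
    simp only [← hreal]
    rw [← ENNReal.tsum_toReal_eq fun ω => ENNReal.ne_top_of_tsum_ne_top hne ω]
    exact ENNReal.toReal_le_of_le_ofReal hB h
  -- A series that is not summable has the default value `0`, which is at most `B`.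
  by_cases hf : Summable fun ω => (p ω).toReal * f ω
  · exact (hf.tsum_le_tsum (fun ω => by gcongr; exact hfg ω) hsum).trans htsum
  · rw [expect, tsum_eq_zero_of_not_summable hf]
    exact hB

end Eexpect

/-! ### Exponential weights and its potential -/

section ExpWeights

theorem binaryLoss_nonneg (a b : A) : 0 ≤ binaryLoss a b := by
  unfold binaryLoss
  split_ifs <;> norm_num

theorem binaryLoss_self (a : A) : binaryLoss a a = 0 := by simp [binaryLoss]

theorem binaryLoss_of_ne {a b : A} (h : a ≠ b) : binaryLoss a b = 1 := by simp [binaryLoss, h]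

/-- The total weight of the policies in `Q` after the history `F`. -/
noncomputable def totalWeight (η : ℝ) (Q : Finset (S → A)) (F : History S A) : ℝ :=
  ∑ π ∈ Q, Real.exp (-η * observedLoss F π)

theorem totalWeight_pos {η : ℝ} {Q : Finset (S → A)} (hQ : Q.Nonempty) (F : History S A) :
    0 < totalWeight η Q F :=
  Finset.sum_pos (fun _ _ => Real.exp_pos _) hQ

open Classical in
/-- The law of the action that the exponential weights forecaster takes. -/
noncomputable def expWeightsLaw [Fintype A] (η : ℝ) (Q : Finset (S → A)) (hQ : Q.Nonempty)
    (F : History S A) (s : S) : PMF A :=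
  PMF.ofFintype
    (fun a => ENNReal.ofReal
      ((∑ π ∈ Q with π s = a, Real.exp (-η * observedLoss F π)) / totalWeight η Q F)) <| by
    have hW := totalWeight_pos (η := η) hQ F
    rw [← ENNReal.ofReal_sum_of_nonneg fun a _ => by positivity, ← Finset.sum_div,
      Finset.sum_fiberwise Q (fun π => π s), ← totalWeight, div_self hW.ne', ENNReal.ofReal_one]

/-- The full-feedback exponential weights algorithm. -/
noncomputable def expWeights [Fintype A] (η : ℝ) (Q : Finset (S → A)) (hQ : Q.Nonempty) :
    Algorithm S A where
  query _ _ := PMF.pure true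
  act F s _ := expWeightsLaw η Q hQ F s

theorem expWeights_isExpWeights [Fintype A] (η : ℝ) (Q : Finset (S → A)) (hQ : Q.Nonempty) :
    IsExpWeights η Q (expWeights η Q hQ) := by
  intro F s o a
  have hW := totalWeight_pos (η := η) hQ F
  exact ENNReal.toReal_ofReal (by positivity)

theorem observedLoss_nil (π : S → A) : observedLoss [] π = 0 := by simp [observedLoss]

theorem toHistory_concat (τ : List (Round S A)) (r : Round S A) :
    toHistory (τ ++ [r]) =
      toHistory τ ++ [(r.state, r.action, queryResult r.correct r.query)] := by
  simp [toHistory]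

theorem observedLoss_concat (F : History S A) (s : S) (a am : A) (π : S → A) :
    observedLoss (F ++ [(s, a, some am)]) π = observedLoss F π + binaryLoss (π s) am := by
  simp [observedLoss]

theorem eexpect_binaryLoss (p : PMF A) (am : A) :
    eexpect p (fun a => ENNReal.ofReal (binaryLoss a am)) = ENNReal.ofReal (1 - (p am).toReal) := by
  classical
  have h : eexpect p (fun a => ENNReal.ofReal (binaryLoss a am)) + p am = 1 := by
    have h1 : p am = eexpect p fun a => if a = am then 1 else 0 := by
      simp [eexpect]
    conv_lhs => rw [h1]
    rw [← eexpect_add]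
    refine Eq.trans ?_ (eexpect_const p 1)
    congr 1
    funext a
    by_cases h : a = am <;> simp [h, binaryLoss]
  rw [ENNReal.ofReal_sub _ ENNReal.toReal_nonneg, ENNReal.ofReal_toReal (p.apply_ne_top am),
    ENNReal.ofReal_one]
  exact ENNReal.eq_sub_of_add_eq (p.apply_ne_top am) h

/-- A mistake of the exponential weights forecaster that has probability `p` decreases the
logarithm of the total weight by at least `p / 2` on average. -/
theorem log_totalWeight_concat_le {Q : Finset (S → A)} (hQ : Q.Nonempty) {Γ : Algorithm S A}
    (hΓ : IsExpWeights 1 Q Γ) (F : History S A) (s : S) (o : Option A) (a am : A) :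
    2 * Real.log (totalWeight 1 Q (F ++ [(s, a, some am)])) + (1 - (Γ.act F s o am).toReal) ≤
      2 * Real.log (totalWeight 1 Q F) := by
  classical
  have hW := totalWeight_pos (η := 1) hQ F
  have hW' := totalWeight_pos (η := 1) hQ (F ++ [(s, a, some am)])
  set W := totalWeight 1 Q F with hWdef
  set W' := totalWeight 1 Q (F ++ [(s, a, some am)]) with hWdef'
  have hp : (Γ.act F s o am).toReal = (∑ π ∈ Q with π s = am, Real.exp (-1 * observedLoss F π)) / W := by
    rw [hΓ F s o am, hWdef, totalWeight]
  have hle : (Γ.act F s o am).toReal ≤ 1 := by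
    simpa using ENNReal.toReal_mono ENNReal.one_ne_top ((Γ.act F s o).coe_le_one am)
  set p := (Γ.act F s o am).toReal
  -- Policies correct at `s` hold weight `p * W` and keep it; the others are scaled by `exp (-1)`.
  -- As `1 - exp (-1) ≥ 1 / 2`, `log x ≤ x - 1` then gives the factor 2.
  have hupd : W' = Real.exp (-1) * W + (1 - Real.exp (-1)) * (p * W) := by
    rw [hp, div_mul_cancel₀ _ hW.ne', hWdef, hWdef', totalWeight, totalWeight, Finset.sum_filter,
      Finset.mul_sum, Finset.mul_sum, ← Finset.sum_add_distrib]
    refine Finset.sum_congr rfl fun π _ => ?_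
    rw [observedLoss_concat]
    by_cases h : π s = am
    · rw [if_pos h, h, binaryLoss_self, add_zero]
      ring
    · rw [if_neg h, binaryLoss_of_ne h, mul_add, Real.exp_add]
      ring_nf
  have he : Real.exp (-1) ≤ 1 / 2 := by
    rw [Real.exp_neg, inv_le_comm₀ (Real.exp_pos _) (by norm_num)]
    have := Real.add_one_le_exp (1 : ℝ)
    norm_num at this ⊢
    exact this
  have hratio : W' / W = 1 - (1 - Real.exp (-1)) * (1 - p) := by
    rw [hupd]
    field_simp
    ring
  have hlog := Real.log_le_sub_one_of_pos (div_pos hW' hW)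
  rw [Real.log_div hW'.ne' hW.ne', hratio] at hlog
  nlinarith

/-- The cumulative loss of the algorithm plus twice the gap between the loss of `π` and the
soft minimum of the losses of the policies in `Q`. -/
noncomputable def potential (Q : Finset (S → A)) (π : S → A) (τ : List (Round S A)) : ℝ :=
  (τ.map fun r => binaryLoss r.action r.correct).sum +
    2 * (Real.log (totalWeight 1 Q (toHistory τ)) + observedLoss (toHistory τ) π)

/-- The total weight is at least the single weight of `π`. -/
theorem log_totalWeight_add_observedLoss_nonneg {Q : Finset (S → A)} {π : S → A} (hπ : π ∈ Q)
    (F : History S A) : 0 ≤ Real.log (totalWeight 1 Q F) + observedLoss F π := by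
  have h : Real.exp (-1 * observedLoss F π) ≤ totalWeight 1 Q F :=
    Finset.single_le_sum (f := fun π => Real.exp (-1 * observedLoss F π))
      (fun _ _ => (Real.exp_pos _).le) hπ
  have := Real.log_le_log (Real.exp_pos _) h
  rw [Real.log_exp] at this
  linarith

theorem loss_le_potential {Q : Finset (S → A)} {π : S → A} (hπ : π ∈ Q) (τ : List (Round S A)) :
    (τ.map fun r => binaryLoss r.action r.correct).sum ≤ potential Q π τ := by
  have := log_totalWeight_add_observedLoss_nonneg hπ (toHistory τ)
  rw [potential]
  linarith

theorem sum_binaryLoss_nonneg (τ : List (Round S A)) (f g : Round S A → A) :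
    0 ≤ (τ.map fun r => binaryLoss (f r) (g r)).sum := by
  refine List.sum_nonneg fun x hx => ?_
  obtain ⟨r, -, rfl⟩ := List.mem_map.1 hx
  exact binaryLoss_nonneg _ _

theorem potential_nonneg {Q : Finset (S → A)} {π : S → A} (hπ : π ∈ Q) (τ : List (Round S A)) :
    0 ≤ potential Q π τ :=
  (sum_binaryLoss_nonneg τ _ _).trans (loss_le_potential hπ τ)

/-- The drop in log-weight pays for the algorithm's expected loss, leaving only the loss of `π`. -/
theorem eexpect_act_potential_le {Q : Finset (S → A)} {Γ : Algorithm S A}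
    (hΓ : IsExpWeights 1 Q Γ) {π : S → A} (hπ : π ∈ Q) (τ : List (Round S A)) (s : S) (am : A)
    (o : Option A) :
    eexpect (Γ.act (toHistory τ) s o)
        (fun a => ENNReal.ofReal (potential Q π (τ ++ [⟨s, am, true, a⟩]))) ≤
      ENNReal.ofReal (potential Q π τ) + 2 * ENNReal.ofReal (binaryLoss (π s) am) := by
  set F := toHistory τ with hF
  set p := Γ.act F s o with hp
  set K : ℝ := (τ.map fun r => binaryLoss r.action r.correct).sum +
    2 * (Real.log (totalWeight 1 Q (F ++ [(s, am, some am)])) +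
      observedLoss (F ++ [(s, am, some am)]) π) with hK
  have hK0 : 0 ≤ K := by
    have h1 := log_totalWeight_add_observedLoss_nonneg hπ (F ++ [(s, am, some am)])
    have h2 : 0 ≤ (τ.map fun r => binaryLoss r.action r.correct).sum := sum_binaryLoss_nonneg τ _ _
    rw [hK]
    linarith
  have hobs : ∀ (a : A) (π' : S → A), observedLoss (F ++ [(s, a, some am)]) π' =
      observedLoss (F ++ [(s, am, some am)]) π' := fun a π' => by simp only [observedLoss_concat]
  have hpot : ∀ a, potential Q π (τ ++ [⟨s, am, true, a⟩]) = K + binaryLoss a am := by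
    intro a
    simp only [potential, toHistory_concat, queryResult, if_true, totalWeight, ← hF, hobs a, hK,
      List.map_append, List.map_cons, List.map_nil, List.sum_append, List.sum_cons, List.sum_nil]
    ring
  have hle : (p am).toReal ≤ 1 := by
    simpa using ENNReal.toReal_mono ENNReal.one_ne_top (p.coe_le_one am)
  simp only [hpot, ENNReal.ofReal_add hK0 (binaryLoss_nonneg _ _)]
  rw [eexpect_add, eexpect_const, eexpect_binaryLoss, ← ENNReal.ofReal_add hK0 (by linarith),
    ← ENNReal.ofReal_ofNat 2, ← ENNReal.ofReal_mul (by norm_num),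
    ← ENNReal.ofReal_add (potential_nonneg hπ τ) (mul_nonneg (by norm_num) (binaryLoss_nonneg _ _))]
  refine ENNReal.ofReal_le_ofReal ?_
  have := log_totalWeight_concat_le ⟨π, hπ⟩ hΓ F s o am am
  rw [hK, observedLoss_concat, potential, ← hF]
  linarith

theorem eexpect_ofReal_binaryLoss (p : PMF (S × A)) (π : S → A) :
    eexpect p (fun x => ENNReal.ofReal (binaryLoss (π x.1) x.2)) =
      p.toOuterMeasure {x | π x.1 ≠ x.2} := by
  rw [PMF.toOuterMeasure_apply, eexpect]
  refine tsum_congr fun x => ?_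
  by_cases h : π x.1 = x.2 <;> simp [h, binaryLoss]

theorem eexpect_playRound_potential_le {Q : Finset (S → A)} {Γ : Algorithm S A}
    (hfull : Γ.IsFullFeedback) (hΓ : IsExpWeights 1 Q Γ) {π : S → A} (hπ : π ∈ Q)
    (V : Adversary S A) (τ : List (Round S A)) :
    eexpect (playRound Γ V (toHistory τ))
        (fun r => ENNReal.ofReal (potential Q π (τ ++ [r]))) ≤
      ENNReal.ofReal (potential Q π τ) +
        2 * (V (toHistory τ)).toOuterMeasure {x | π x.1 ≠ x.2} := by
  rw [playRound, eexpect_bind, ← eexpect_ofReal_binaryLoss, ← eexpect_const_mul,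
    ← eexpect_const (V (toHistory τ)) (ENNReal.ofReal (potential Q π τ)), ← eexpect_add]
  refine eexpect_mono fun x _ => ?_
  rw [hfull, PMF.pure_bind, eexpect_map]
  simpa only [eexpect_const, Function.comp_def] using eexpect_act_potential_le hΓ hπ τ x.1 x.2 _

end ExpWeights

/-! ### Smooth realizable play -/

section Play

/-- Realizability concerns only plays of full length `T`; extending prefixes carries it to earlier
rounds. -/
theorem exists_extension_mem_support_play (Γ : Algorithm S A) (V : Adversary S A) {t T : ℕ}
    (htT : t ≤ T) {τ : List (Round S A)} (hτ : τ ∈ (play Γ V t).support) :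
    ∃ τ' ∈ (play Γ V T).support, ∀ r ∈ τ, r ∈ τ' := by
  induction T, htT using Nat.le_induction with
  | base => exact ⟨τ, hτ, fun _ h => h⟩
  | succ T _ ih =>
    obtain ⟨τ', hτ', hsub⟩ := ih
    obtain ⟨r, hr⟩ := (playRound Γ V (toHistory τ')).support_nonempty
    refine ⟨τ' ++ [r], ?_, fun x hx => List.mem_append_left _ (hsub x hx)⟩
    rw [play, PMF.mem_support_bind_iff]
    exact ⟨τ', hτ', (PMF.mem_support_map_iff _ _ _).2 ⟨r, hr, rfl⟩⟩

theorem correct_eq_of_realizable {Γ : Algorithm S A} {V : Adversary S A} {T : ℕ} {π : S → A}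
    (hπ : ∀ τ ∈ (play Γ V T).support, ∀ r ∈ τ, π r.state = r.correct) {t : ℕ} (htT : t < T)
    {τ : List (Round S A)} (hτ : τ ∈ (play Γ V t).support) {x : S × A}
    (hx : x ∈ (V (toHistory τ)).support) : π x.1 = x.2 := by
  obtain ⟨q, hq⟩ := (Γ.query (toHistory τ) x.1).support_nonempty
  obtain ⟨a, ha⟩ := (Γ.act (toHistory τ) x.1 (queryResult x.2 q)).support_nonempty
  have hr : (⟨x.1, x.2, q, a⟩ : Round S A) ∈ (playRound Γ V (toHistory τ)).support := by
    rw [playRound, PMF.mem_support_bind_iff]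
    refine ⟨x, hx, ?_⟩
    rw [PMF.mem_support_bind_iff]
    exact ⟨q, hq, (PMF.mem_support_map_iff _ _ _).2 ⟨a, ha, rfl⟩⟩
  have hmem : τ ++ [⟨x.1, x.2, q, a⟩] ∈ (play Γ V (t + 1)).support := by
    rw [play, PMF.mem_support_bind_iff]
    exact ⟨τ, hτ, (PMF.mem_support_map_iff _ _ _).2 ⟨_, hr, rfl⟩⟩
  obtain ⟨τ', hτ', hsub⟩ := exists_extension_mem_support_play Γ V htT hmem
  exact hπ τ' hτ' ⟨x.1, x.2, q, a⟩ (hsub _ (by simp))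

/-- Where `π'` is correct, an error of `π` is a disagreement with `π'`, an event of the state alone
to which smoothness applies. -/
theorem toOuterMeasure_ne_le_of_isSmooth {σ ε : ℝ} (hσ : 0 < σ) {β : PMF S} {p : PMF (S × A)}
    (hp : IsSmooth σ β (p.map Prod.fst)) {π' π : S → A}
    (hπ' : ∀ x ∈ p.support, π' x.1 = x.2)
    (hclose : β.toOuterMeasure {s | π' s ≠ π s} ≤ ENNReal.ofReal ε) :
    p.toOuterMeasure {x | π x.1 ≠ x.2} ≤ ENNReal.ofReal (1 / σ * ε) := by
  calc p.toOuterMeasure {x | π x.1 ≠ x.2}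
      ≤ p.toOuterMeasure (Prod.fst ⁻¹' {s | π' s ≠ π s}) := by
        refine PMF.toOuterMeasure_mono p fun x hx => ?_
        have := hπ' x hx.2
        simpa [this, eq_comm] using hx.1
    _ = (p.map Prod.fst).toOuterMeasure {s | π' s ≠ π s} :=
        (PMF.toOuterMeasure_map_apply _ _ _).symm
    _ ≤ ENNReal.ofReal (1 / σ) * β.toOuterMeasure {s | π' s ≠ π s} := hp hσ _
    _ ≤ ENNReal.ofReal (1 / σ) * ENNReal.ofReal ε := by gcongr
    _ = _ := (ENNReal.ofReal_mul (by positivity)).symm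

theorem eexpect_play_potential_le {Q : Finset (S → A)} {Γ : Algorithm S A}
    (hfull : Γ.IsFullFeedback) (hΓ : IsExpWeights 1 Q Γ) {σ ε : ℝ} (hσ : 0 < σ) {β : PMF S}
    {V : Adversary S A} (hV : V.IsSmooth σ β) {T : ℕ} {π' π : S → A} (hπ : π ∈ Q)
    (hπ' : ∀ τ ∈ (play Γ V T).support, ∀ r ∈ τ, π' r.state = r.correct)
    (hclose : β.toOuterMeasure {s | π' s ≠ π s} ≤ ENNReal.ofReal ε) {t : ℕ} (ht : t ≤ T) :
    eexpect (play Γ V t) (fun τ => ENNReal.ofReal (potential Q π τ)) ≤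
      ENNReal.ofReal (2 * Real.log Q.card) + t * (2 * ENNReal.ofReal (1 / σ * ε)) := by
  induction t with
  | zero =>
    simp [play, eexpect_pure, potential, toHistory, totalWeight, observedLoss_nil]
  | succ t ih =>
    rw [play, eexpect_bind]
    calc _ ≤ eexpect (play Γ V t) (fun τ => ENNReal.ofReal (potential Q π τ) +
            2 * ENNReal.ofReal (1 / σ * ε)) := by
          refine eexpect_mono fun τ hτ => ?_
          rw [eexpect_map]
          refine (eexpect_playRound_potential_le hfull hΓ hπ V τ).trans ?_
          gcongr
          exact toOuterMeasure_ne_le_of_isSmooth hσ (hV _)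
            (fun x hx => correct_eq_of_realizable hπ' ht hτ hx) hclose
      _ ≤ _ := by
          rw [eexpect_add, eexpect_const, Nat.cast_succ, add_mul, one_mul, ← add_assoc]
          gcongr
          exact ih (by omega)

/-- The regret of exponential weights on a cover against a smooth realizable adversary. -/
theorem regret_le_of_isCover {P : Set (S → A)} {Q : Finset (S → A)} {Γ : Algorithm S A}
    (hfull : Γ.IsFullFeedback) (hΓ : IsExpWeights 1 Q Γ) {σ ε : ℝ} (hσ : 0 < σ) (hε : 0 ≤ ε)
    {β : PMF S} (hQ : IsCover ε β P Q) {V : Adversary S A} (hV : V.IsSmooth σ β) {T : ℕ}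
    (hreal : IsRealizable P T Γ V) :
    regret P T Γ V binaryLoss ≤ ((2 * Real.log Q.card + 2 * (T * ε) * σ⁻¹ : ℝ) : EReal) := by
  obtain ⟨π', hπ'P, hπ'⟩ := hreal
  obtain ⟨π, hπ, hclose⟩ := hQ π' hπ'P
  have hlog : 0 ≤ Real.log Q.card := Real.log_natCast_nonneg _
  -- The comparator's loss is nonnegative and is dropped: the algorithm's own loss is bounded,
  -- uniformly in `ρ`.
  refine iSup₂_le fun ρ _ => EReal.coe_le_coe_iff.2 ?_
  refine expect_le_of_eexpect_le (g := potential Q π) _ (fun τ => ?_) (potential_nonneg hπ)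
    (by positivity) ((eexpect_play_potential_le hfull hΓ hσ hV hπ hπ' hclose le_rfl).trans_eq ?_)
  · have h1 := loss_le_potential hπ τ
    have h2 := sum_binaryLoss_nonneg τ (fun r => ρ r.state) (fun r => r.correct)
    linarith
  · rw [← ENNReal.ofReal_natCast, ← ENNReal.ofReal_ofNat 2, ← ENNReal.ofReal_mul (by norm_num),
      ← ENNReal.ofReal_mul (by positivity), ← ENNReal.ofReal_add (by positivity) (by positivity)]
    congr 1
    rw [one_div]
    ring

end Play

/-! ### Choice of scale and constants -/

/-- A VC class has a `1 / T`-cover whose metric entropy is `O(d log T)`, up to an additive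
constant. -/
theorem exists_isCover_one_div [Fintype A] (hA : Fintype.card A = 2) (β : PMF S)
    {P : Set (S → A)} {d : ℕ} (hd : HasVCDim P d) (T : ℕ) :
    ∃ Q : Finset (S → A), Q.Nonempty ∧ (1 ≤ T → IsCover (1 / (T : ℝ)) β P Q ∧
      Real.log Q.card ≤ 6 * d * Real.log T + 1 / 2) := by
  have : Nonempty A := Fintype.card_pos_iff.1 (by omega)
  -- For `T = 1` the term `log T` vanishes, but any single policy is a `1`-cover. For `T ≥ 2`, `4 *
  -- T ≤ T ^ 3` absorbs the constant 4.
  rcases lt_or_ge T 2 with hT | hT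
  · refine ⟨{fun _ => Classical.arbitrary A}, Finset.singleton_nonempty _, fun hT1 => ?_⟩
    obtain rfl : T = 1 := by omega
    refine ⟨fun π _ => ⟨_, Finset.mem_singleton_self _, ?_⟩, by simp⟩
    calc β.toOuterMeasure _ ≤ β.toOuterMeasure Set.univ := MeasureTheory.measure_mono (Set.subset_univ _)
      _ = 1 := (PMF.toOuterMeasure_apply_eq_one_iff _ _).2 (Set.subset_univ _)
      _ = _ := by simp
  · have hT' : (2 : ℝ) ≤ T := by exact_mod_cast hT
    obtain ⟨Q, hne, hcov, hlog⟩ := exists_isCover_log_card_le hA β hd (ε := 1 / (T : ℝ))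
      (by positivity) (by rw [div_le_one (by positivity)]; linarith)
    refine ⟨Q, hne, fun _ => ⟨hcov, hlog.trans ?_⟩⟩
    have h4 : Real.log (4 / (1 / (T : ℝ))) ≤ 3 * Real.log T := by
      have h3 : (3 : ℝ) * Real.log T = Real.log ((T : ℝ) ^ 3) := by simp [Real.log_pow]
      rw [h3]
      refine Real.log_le_log (by positivity) ?_
      rw [div_div_eq_mul_div, div_one]
      nlinarith [mul_nonneg (show (0 : ℝ) ≤ T by linarith) (show (0 : ℝ) ≤ T - 2 by linarith)]
    nlinarith [mul_le_mul_of_nonneg_left h4 (Nat.cast_nonneg (α := ℝ) d)]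

end OnlineLearning

/-- The constant `C` is absolute; the algorithm may depend on the known horizon `T`, the baseline
`β` and the class `P`, but neither on `σ` nor on the adversary. Here `σ⁻¹ = σ⁺`. -/
theorem lemma2p3 :
    ∃ C : ℝ, 0 < C ∧
      ∀ (S : Type u) [Countable S] (A : Type v) [Fintype A], Fintype.card A = 2 →
      ∀ (β : PMF S) (P : Set (S → A)) (d : ℕ), OnlineLearning.HasVCDim P d →
      ∃ Γ : ℕ → OnlineLearning.Algorithm S A,
        (∀ T : ℕ, (Γ T).IsFullFeedback ∧ (Γ T).IsQueryAgnostic) ∧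
        ∀ T : ℕ, 1 ≤ T →
          (∃ (η : ℝ) (Q : Finset (S → A)), 0 < η ∧
            OnlineLearning.IsCover (1 / (T : ℝ)) β P Q ∧
            OnlineLearning.IsExpWeights η Q (Γ T)) ∧
          ∀ σ : ℝ, 0 < σ → σ ≤ 1 →
          ∀ V : OnlineLearning.Adversary S A, V.IsSmooth σ β →
            OnlineLearning.IsRealizable P T (Γ T) V →
            OnlineLearning.regret P T (Γ T) V OnlineLearning.binaryLoss ≤
              ((C * ((d : ℝ) * Real.log (T : ℝ) + σ⁻¹) : ℝ) : EReal) := by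
  refine ⟨12, by norm_num, fun S _ A _ hA β P d hd => ?_⟩
  choose Q hne hQ using OnlineLearning.exists_isCover_one_div hA β hd
  refine ⟨fun T => OnlineLearning.expWeights 1 (Q T) (hne T),
    fun T => ⟨fun _ _ => rfl, fun _ _ _ => rfl⟩, fun T hT => ?_⟩
  have hexp := OnlineLearning.expWeights_isExpWeights 1 (Q T) (hne T)
  obtain ⟨hcov, hlog⟩ := hQ T hT
  refine ⟨⟨1, Q T, one_pos, hcov, hexp⟩, fun σ hσ hσ1 V hV hreal => ?_⟩
  refine (OnlineLearning.regret_le_of_isCover (fun _ _ => rfl) hexp hσ (by positivity) hcov hV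
    hreal).trans (EReal.coe_le_coe_iff.2 ?_)
  have hT0 : (T : ℝ) ≠ 0 := by positivity
  rw [mul_one_div_cancel hT0]
  -- The bound is now `12 d log T + 1 + 2 σ⁻¹`; the additive `1` is absorbed by `σ⁻¹`.
  have hσ' : 1 ≤ σ⁻¹ := (one_le_inv₀ hσ).2 hσ1
  linarith
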